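/- Let $I=[0,1]\cup\{\infty\}$. For $\tau\in[0,1]$, $\kappa\in\{1,2\}$ and $x,y\in I$ let $\chi[\tau,\kappa](x,y)=x$ if $\kappa=1$ and $x>\tau$; $\chi[\tau,\kappa](x,y)=\infty$ if $\kappa=1$ and $x\le\tau$; and $\chi[\tau,\kappa](x,y)=x\wedge y$ if $\kappa=2$. A probability measure $\rho^{(2)}$ on $I^2$ is a solution of the bivariate RDE if $$(Y_\varnothing,Y'_\varnothing)\stackrel{d}{=}\big(\chi[\omega](Y_1,Y_2),\chi[\omega](Y'_1,Y'_2)\big),$$ where $(Y_\varnothing,Y'_\varnothing)$ has law $\rho^{(2)}$, $(Y_1,Y'_1)$ and $(Y_2,Y'_2)$ are independent with law $\rho^{(2)}$, and $\omega$ is independent of them and uniformly distributed on $[0,1]\times\{1,2\}$. Call $\rho^{(2)}$ symmetric if it is invariant under $(y_1,y_2)\mapsto(y_2,y_1)$, and let $\mathcal M^{(2)}$ be the set of symmetric probability measures $\rho^{(2)}$ on $I^2$ with $\rho^{(2)}([0,t]\times I\cup I\times[0,t])\le t$ for all $0\le t\le 1$. For $t>0$ let $\psi_t:I\to I$ be given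 by $\psi_t(y)=t^{-1}y$ if $y\le t$ and $\psi_t(y)=\infty$ otherwise, let $\psi^{(2)}_t(y,y')=(\psi_t(y),\psi_t(y'))$, and for $\rho\in\mathcal M^{(2)}$ let $$\Gamma^{(2)}_t\rho=t^{-1}\,\rho\circ(\psi^{(2)}_t)^{-1}+(1-t^{-1})\,\delta_{(\infty,\infty)}.$$ Let $\rho^{(2)}$ be a symmetric solution of the bivariate RDE. Then $\rho^{(2)}\in\mathcal M^{(2)}$, and for each $t>0$ the signed measure $\Gamma^{(2)}_t\rho^{(2)}$ is a probability measure in $\mathcal M^{(2)}$ and is also a solution of the bivariate RDE. -/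

import Mathlib

open MeasureTheory
open scoped ENNReal

noncomputable section

namespace FrozenPercolation

/-- The space `I = [0,1] ∪ {∞}`, with the order and the (Borel) measurable structure
inherited from `[0,∞]`. -/
abbrev BurnTime : Type := {y : ℝ≥0∞ // y ≤ 1 ∨ y = ∞}

namespace BurnTime

/-- The point `∞` of `I`. -/
def infty : BurnTime := ⟨∞, Or.inr rfl⟩

/-- The subset `[0,t]` of `I`. -/
def upTo (t : ℝ) : Set BurnTime := {y | (y : ℝ≥0∞) ≤ ENNReal.ofReal t}

end BurnTime

/-- The space `[0,1] × {1,2}` of the marks `ω = (τ, κ)`. -/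
abbrev Mark : Type := unitInterval × Set.Icc (1 : ℕ) 2

/-- The uniform distribution on `[0,1] × {1,2}`. -/
def markLaw : Measure Mark :=
  (volume : Measure unitInterval).prod
    (ProbabilityTheory.uniformOn (Set.univ : Set (Set.Icc (1 : ℕ) 2)))

/-- The map `χ[τ,κ](x,y)`: for `κ = 1` it is `x` if `x > τ` and `∞` if `x ≤ τ`;
for `κ = 2` it is `x ∧ y`. -/
def chi (ω : Mark) (x y : BurnTime) : BurnTime :=
  if (ω.2 : ℕ) = 1 then
    if ENNReal.ofReal (ω.1 : ℝ) < (x : ℝ≥0∞) then x else BurnTime.infty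
  else min x y

/-- The law of `(χ[ω](Y₁,Y₂), χ[ω](Y'₁,Y'₂))`, where `(Y₁,Y'₁)` and `(Y₂,Y'₂)` are independent
with law `ρ`, and `ω` is independent of them and uniform on `[0,1] × {1,2}`. -/
def bivariateMap (ρ : ProbabilityMeasure (BurnTime × BurnTime)) :
    Measure (BurnTime × BurnTime) :=
  (markLaw.prod ((ρ : Measure (BurnTime × BurnTime)).prod
      (ρ : Measure (BurnTime × BurnTime)))).map
    fun p => (chi p.1 p.2.1.1 p.2.2.1, chi p.1 p.2.1.2 p.2.2.2)

/-- `ρ` solves the bivariate recursive distributional equation. -/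
def SolvesBivariateRDE (ρ : ProbabilityMeasure (BurnTime × BurnTime)) : Prop :=
  (ρ : Measure (BurnTime × BurnTime)) = bivariateMap ρ

/-- A probability measure on `I²` is symmetric if it is invariant under
`(y₁,y₂) ↦ (y₂,y₁)`. -/
def IsSymmetricLaw (ρ : ProbabilityMeasure (BurnTime × BurnTime)) : Prop :=
  (ρ : Measure (BurnTime × BurnTime)).map Prod.swap = (ρ : Measure (BurnTime × BurnTime))

/-- The space `ℳ⁽²⁾` of symmetric probability measures on `I²` that give mass at most `t` to
`[0,t] × I ∪ I × [0,t]`, for all `0 ≤ t ≤ 1`. -/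
def scalableLaws : Set (ProbabilityMeasure (BurnTime × BurnTime)) :=
  {ρ | IsSymmetricLaw ρ ∧ ∀ t : ℝ, 0 ≤ t → t ≤ 1 →
    (ρ : Measure (BurnTime × BurnTime))
      (BurnTime.upTo t ×ˢ Set.univ ∪ Set.univ ×ˢ BurnTime.upTo t) ≤ ENNReal.ofReal t}

theorem scale_mem {t : ℝ} {y : BurnTime} (h : (y : ℝ≥0∞) ≤ ENNReal.ofReal t) :
    (ENNReal.ofReal t)⁻¹ * (y : ℝ≥0∞) ≤ 1 ∨ (ENNReal.ofReal t)⁻¹ * (y : ℝ≥0∞) = ∞ :=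
  Or.inl ((mul_le_mul_right h _).trans (ENNReal.inv_mul_le_one _))

open Classical in
/-- The scaling map `ψ_t : I → I` for `t > 0`: `y ↦ t⁻¹ y` if `y ≤ t`, and `∞` otherwise. -/
def psi (t : ℝ) (y : BurnTime) : BurnTime :=
  if h : (y : ℝ≥0∞) ≤ ENNReal.ofReal t then
    ⟨(ENNReal.ofReal t)⁻¹ * (y : ℝ≥0∞), scale_mem h⟩
  else BurnTime.infty

/-- The scaling map `ψ_t` applied to both coordinates. -/
def psi₂ (t : ℝ) (p : BurnTime × BurnTime) : BurnTime × BurnTime := (psi t p.1, psi t p.2)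

/-- `Γ⁽²⁾_t ρ = t⁻¹ (ρ ∘ (ψ⁽²⁾_t)⁻¹) + (1 - t⁻¹) δ_(∞,∞)` for `t > 0`. For `t < 1` the second
coefficient is negative, so this is a priori only a signed measure. -/
def gamma₂ (t : ℝ) (ρ : ProbabilityMeasure (BurnTime × BurnTime)) :
    SignedMeasure (BurnTime × BurnTime) :=
  t⁻¹ • ((ρ : Measure (BurnTime × BurnTime)).map (psi₂ t)).toSignedMeasure +
    (1 - t⁻¹) • (Measure.dirac (BurnTime.infty, BurnTime.infty)).toSignedMeasure

/-- Measurability of `χ`, so that the laws in `bivariateMap` are the intended ones. -/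
theorem measurable_chi :
    Measurable fun p : Mark × (BurnTime × BurnTime) => chi p.1 p.2.1 p.2.2 := by
  unfold chi
  refine Measurable.ite ?_ (Measurable.ite ?_ ?_ ?_) ?_
  · exact (measurable_subtype_coe.comp measurable_fst.snd) (measurableSet_singleton 1)
  · exact measurableSet_lt
      (ENNReal.measurable_ofReal.comp (measurable_subtype_coe.comp measurable_fst.fst))
      (measurable_subtype_coe.comp measurable_snd.fst)
  · exact measurable_snd.fst
  · exact measurable_const
  · have h1 : Measurable fun p : Mark × (BurnTime × BurnTime) => (p.2.1 : ℝ≥0∞) :=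
      measurable_subtype_coe.comp measurable_snd.fst
    have h2 : Measurable fun p : Mark × (BurnTime × BurnTime) => (p.2.2 : ℝ≥0∞) :=
      measurable_subtype_coe.comp measurable_snd.snd
    simp only [min_def]
    exact Measurable.ite (measurableSet_le h1 h2 :) measurable_snd.fst measurable_snd.snd

theorem measurable_psi (t : ℝ) : Measurable (psi t) := by
  refine Measurable.subtype_mk (f := fun y : BurnTime => ((psi t y : BurnTime) : ℝ≥0∞)) ?_
    (h := fun y => (psi t y).2)
  have : (fun y : BurnTime => ((psi t y : BurnTime) : ℝ≥0∞)) = fun y : BurnTime =>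
      if (y : ℝ≥0∞) ≤ ENNReal.ofReal t then (ENNReal.ofReal t)⁻¹ * (y : ℝ≥0∞) else ∞ := by
    funext y
    unfold psi BurnTime.infty
    split_ifs <;> rfl
  rw [this]
  refine Measurable.ite (measurableSet_le measurable_subtype_coe measurable_const)
    (measurable_subtype_coe.const_mul _) measurable_const

end FrozenPercolation

end

open MeasureTheory Set
open scoped ENNReal

noncomputable section

namespace FrozenPercolation

/-! The RDE is used in weak form, against bounded measurable `f`. For `f` the indicator of `burntBy
t`, of mass `G`, the minimum contributes `2G - G²`, and the cut at `s` contributes at most `G` if `s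
≤ t` and nothing if `s > t`. So `G = (cut part)/2 + (2G - G²)/2` gives `G² ≤ tG`, hence `G ≤ t`.

This bound makes the scaled law positive: for `t < 1`, `psi₂ t` sends mass at least `1 - t` to
`infty₂`, enough to absorb the negative atom.

The RDE survives scaling because `psi t` is monotone, so it commutes with minima, and it turns a cut
at `s` into a cut at `ts` (`cut_psi`). Since `infty₂` is neutral for the minimum and fixed by cuts,
the RDE for the scaled law reduces to `t⁻²` times the RDE for `ρ` tested on `f ∘ psi₂ t`. -/

/-! ### Algebra of cutting, scaling and minima -/

/-- The point `(∞,∞)` of `I²`. -/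
def infty₂ : BurnTime × BurnTime := (BurnTime.infty, BurnTime.infty)

/-- The set `[0,t] × I ∪ I × [0,t]`. -/
def burntBy (t : ℝ) : Set (BurnTime × BurnTime) :=
  BurnTime.upTo t ×ˢ univ ∪ univ ×ˢ BurnTime.upTo t

/-- The map `χ[s,1]` as a function of its first spatial argument, for an arbitrary real `s`. -/
def cut (s : ℝ) (y : BurnTime) : BurnTime :=
  if ENNReal.ofReal s < (y : ℝ≥0∞) then y else BurnTime.infty

/-- The map `cut` applied to both coordinates. -/
def cut₂ (s : ℝ) (p : BurnTime × BurnTime) : BurnTime × BurnTime := (cut s p.1, cut s p.2)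

theorem mem_upTo {t : ℝ} {y : BurnTime} :
    y ∈ BurnTime.upTo t ↔ (y : ℝ≥0∞) ≤ ENNReal.ofReal t := Iff.rfl

theorem mem_burntBy {t : ℝ} {p : BurnTime × BurnTime} :
    p ∈ burntBy t ↔
      (p.1 : ℝ≥0∞) ≤ ENNReal.ofReal t ∨ (p.2 : ℝ≥0∞) ≤ ENNReal.ofReal t := by
  simp [burntBy, mem_upTo]

theorem measurableSet_burntBy (t : ℝ) : MeasurableSet (burntBy t) := by
  have h : MeasurableSet (BurnTime.upTo t) :=
    measurableSet_le measurable_subtype_coe measurable_const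
  exact (h.prod .univ).union (MeasurableSet.univ.prod h)

theorem le_infty (y : BurnTime) : y ≤ BurnTime.infty := by
  change (y : ℝ≥0∞) ≤ ∞
  exact le_top

theorem coe_infty : (BurnTime.infty : ℝ≥0∞) = ∞ := rfl

theorem inf_infty₂ (p : BurnTime × BurnTime) : p ⊓ infty₂ = p :=
  inf_eq_left.2 ⟨le_infty _, le_infty _⟩

theorem infty₂_inf (p : BurnTime × BurnTime) : infty₂ ⊓ p = p :=
  inf_eq_right.2 ⟨le_infty _, le_infty _⟩

theorem eq_infty_of_one_lt {y : BurnTime} (h : 1 < (y : ℝ≥0∞)) : y = BurnTime.infty :=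
  Subtype.ext (y.2.resolve_left h.not_ge)

theorem cut_infty (s : ℝ) : cut s BurnTime.infty = BurnTime.infty := by
  simp [cut]

theorem cut₂_infty₂ (s : ℝ) : cut₂ s infty₂ = infty₂ := by
  simp [cut₂, infty₂, cut_infty]

theorem psi_of_lt {t : ℝ} {y : BurnTime} (h : ENNReal.ofReal t < (y : ℝ≥0∞)) :
    psi t y = BurnTime.infty := dif_neg h.not_ge

theorem psi_infty (t : ℝ) : psi t BurnTime.infty = BurnTime.infty :=
  psi_of_lt (by simp [coe_infty])

theorem coe_psi_of_le {t : ℝ} {y : BurnTime} (h : (y : ℝ≥0∞) ≤ ENNReal.ofReal t) :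
    (psi t y : ℝ≥0∞) = (ENNReal.ofReal t)⁻¹ * (y : ℝ≥0∞) := by
  simp [psi, h]

theorem psi_monotone (t : ℝ) : Monotone (psi t) := by
  intro x y hxy
  rcases le_or_gt (y : ℝ≥0∞) (ENNReal.ofReal t) with hy | hy
  · have hxy' : (x : ℝ≥0∞) ≤ y := hxy
    change (psi t x : ℝ≥0∞) ≤ psi t y
    rw [coe_psi_of_le hy, coe_psi_of_le (hxy'.trans hy)]
    gcongr
  · rw [psi_of_lt hy]
    exact le_infty _

theorem psi₂_inf (t : ℝ) (p q : BurnTime × BurnTime) :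
    psi₂ t (p ⊓ q) = psi₂ t p ⊓ psi₂ t q :=
  Prod.ext ((psi_monotone t).map_min) ((psi_monotone t).map_min)

theorem inv_mul_le_ofReal_iff {t s : ℝ} (ht : 0 < t) (y : ℝ≥0∞) :
    (ENNReal.ofReal t)⁻¹ * y ≤ ENNReal.ofReal s ↔ y ≤ ENNReal.ofReal (t * s) := by
  rw [mul_comm, ← div_eq_mul_inv,
    ENNReal.div_le_iff (by simpa using ht) ENNReal.ofReal_ne_top, ENNReal.ofReal_mul ht.le,
    mul_comm]

/-- The scaling covariance of the cut. Since `t * s` may exceed 1 even when `s` does not, cut levels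
range over all of `ℝ`. -/
theorem cut_psi {t : ℝ} (ht : 0 < t) (s : ℝ) (y : BurnTime) :
    cut s (psi t y) = psi t (cut (t * s) y) := by
  rcases le_or_gt (y : ℝ≥0∞) (ENNReal.ofReal t) with hy | hy
  · have : ENNReal.ofReal s < (psi t y : ℝ≥0∞) ↔ ENNReal.ofReal (t * s) < (y : ℝ≥0∞) := by
      rw [coe_psi_of_le hy, ← not_le, ← not_le, inv_mul_le_ofReal_iff ht]
    unfold cut
    simp only [this]
    split_ifs
    · rfl
    · exact (psi_infty t).symm
  · rw [psi_of_lt hy, cut_infty]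
    unfold cut
    split_ifs
    · exact (psi_of_lt hy).symm
    · exact (psi_infty t).symm

/-- What survives the cut exceeds `s`, so it is either beyond `t` or, if `1 ≤ s`, already `∞`. The
two cases serve `t ≤ 1` and `t ≥ 1` in `integral_cut₂_psi₂`. -/
theorem psi_cut_eq_infty {t s : ℝ} (h : t ≤ s ∨ 1 ≤ s) (y : BurnTime) :
    psi t (cut s y) = BurnTime.infty := by
  unfold cut
  split_ifs with hy
  · rcases h with h | h
    · exact psi_of_lt ((ENNReal.ofReal_le_ofReal h).trans_lt hy)
    · have : 1 < (y : ℝ≥0∞) :=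
        lt_of_le_of_lt (by simpa using ENNReal.ofReal_le_ofReal h) hy
      rw [eq_infty_of_one_lt this, psi_infty]
  · exact psi_infty t

theorem cut₂_psi₂ {t : ℝ} (ht : 0 < t) (s : ℝ) (p : BurnTime × BurnTime) :
    cut₂ s (psi₂ t p) = psi₂ t (cut₂ (t * s) p) := by
  simp [cut₂, psi₂, cut_psi ht]

theorem psi₂_cut₂_eq_infty₂ {t s : ℝ} (h : t ≤ s ∨ 1 ≤ s) (p : BurnTime × BurnTime) :
    psi₂ t (cut₂ s p) = infty₂ := by
  simp [cut₂, psi₂, psi_cut_eq_infty h, infty₂]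

theorem measurable_cut : Measurable fun q : ℝ × BurnTime => cut q.1 q.2 := by
  unfold cut
  exact Measurable.ite (measurableSet_lt (ENNReal.measurable_ofReal.comp measurable_fst)
    (measurable_subtype_coe.comp measurable_snd)) measurable_snd measurable_const

theorem measurable_cut₂ :
    Measurable fun q : ℝ × (BurnTime × BurnTime) => cut₂ q.1 q.2 :=
  (measurable_cut.comp (measurable_fst.prodMk measurable_snd.fst)).prodMk
    (measurable_cut.comp (measurable_fst.prodMk measurable_snd.snd))

theorem measurable_psi₂ (t : ℝ) : Measurable (psi₂ t) :=
  ((measurable_psi t).comp measurable_fst).prodMk ((measurable_psi t).comp measurable_snd)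

/-! ### The two kinds of marks and measurability -/

/-- The marks `(τ,1)`. -/
def cutMark (τ : unitInterval) : Mark := (τ, ⟨1, by simp⟩)

/-- The marks `(τ,2)`. -/
def minMark (τ : unitInterval) : Mark := (τ, ⟨2, by simp⟩)

theorem chi_cutMark (τ : unitInterval) (x y : BurnTime) :
    chi (cutMark τ) x y = cut τ x := by
  simp only [chi, cutMark, cut, if_true]
  congr

theorem chi_minMark (τ : unitInterval) (x y : BurnTime) :
    chi (minMark τ) x y = x ⊓ y := by
  simp [chi, minMark]

/-- The map whose image law defines `bivariateMap`. -/
def chi₂ (p : Mark × ((BurnTime × BurnTime) × (BurnTime × BurnTime))) : BurnTime × BurnTime :=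
  (chi p.1 p.2.1.1 p.2.2.1, chi p.1 p.2.1.2 p.2.2.2)

theorem measurable_chi₂ : Measurable chi₂ :=
  (measurable_chi.comp (measurable_fst.prodMk
    (measurable_snd.fst.fst.prodMk measurable_snd.snd.fst))).prodMk
  (measurable_chi.comp (measurable_fst.prodMk
    (measurable_snd.fst.snd.prodMk measurable_snd.snd.snd)))

theorem measurable_minMark : Measurable minMark := measurable_id.prodMk measurable_const

theorem measurable_inf₂ :
    Measurable fun q : (BurnTime × BurnTime) × (BurnTime × BurnTime) => q.1 ⊓ q.2 := by
  -- The minimum is `chi₂` at a fixed mark with `κ = 2`, so its measurability is inherited.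
  have h := measurable_chi₂.comp ((measurable_const (a := minMark 0)).prodMk
    (measurable_id (α := (BurnTime × BurnTime) × (BurnTime × BurnTime))))
  convert h using 1
  funext q
  exact Prod.ext (chi_minMark 0 _ _).symm (chi_minMark 0 _ _).symm

/-! ### Test functions -/

/-- Bounded measurable real functions. -/
def BddMeasurable {α : Type*} [MeasurableSpace α] (f : α → ℝ) : Prop :=
  Measurable f ∧ ∃ C, ∀ x, |f x| ≤ C

namespace BddMeasurable

variable {α β : Type*} [MeasurableSpace α] [MeasurableSpace β]

theorem const (c : ℝ) : BddMeasurable fun _ : α => c := ⟨measurable_const, |c|, fun _ => le_rfl⟩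

theorem indicator_one {A : Set α} (hA : MeasurableSet A) :
    BddMeasurable (A.indicator (1 : α → ℝ)) := by
  refine ⟨measurable_one.indicator hA, 1, fun x => ?_⟩
  by_cases h : x ∈ A <;> simp [h]

theorem comp {f : β → ℝ} (hf : BddMeasurable f) {g : α → β} (hg : Measurable g) :
    BddMeasurable fun x => f (g x) :=
  ⟨hf.1.comp hg, hf.2.imp fun _ h x => h (g x)⟩

theorem add {f g : α → ℝ} (hf : BddMeasurable f) (hg : BddMeasurable g) :
    BddMeasurable fun x => f x + g x := by
  obtain ⟨hf, C, hC⟩ := hf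
  obtain ⟨hg, D, hD⟩ := hg
  exact ⟨hf.add hg, C + D, fun x => (abs_add_le _ _).trans (add_le_add (hC x) (hD x))⟩

theorem const_mul {f : α → ℝ} (hf : BddMeasurable f) (c : ℝ) :
    BddMeasurable fun x => c * f x := by
  obtain ⟨hf, C, hC⟩ := hf
  refine ⟨hf.const_mul c, |c| * C, fun x => ?_⟩
  rw [abs_mul]
  exact mul_le_mul_of_nonneg_left (hC x) (abs_nonneg c)

theorem integrable {f : α → ℝ} (hf : BddMeasurable f) (μ : Measure α) [IsFiniteMeasure μ] :
    Integrable f μ := by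
  obtain ⟨hf, C, hC⟩ := hf
  exact Integrable.of_bound hf.aestronglyMeasurable C (.of_forall hC)

theorem intervalIntegrable {f : ℝ → ℝ} (hf : BddMeasurable f) (a b : ℝ) :
    IntervalIntegrable f volume a b :=
  ⟨hf.integrable _, hf.integrable _⟩

theorem integral {f : α → β → ℝ} (hf : BddMeasurable (Function.uncurry f)) (μ : Measure β)
    [IsProbabilityMeasure μ] : BddMeasurable fun x => ∫ y, f x y ∂μ := by
  obtain ⟨hf, C, hC⟩ := hf
  refine ⟨(hf.stronglyMeasurable.integral_prod_right).measurable, C, fun x => ?_⟩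
  have := norm_integral_le_of_norm_le_const (μ := μ) (f := f x) (C := C)
    (.of_forall fun y => hC (x, y))
  simpa using this

end BddMeasurable

/-! ### The RDE in weak form -/

instance : IsProbabilityMeasure
    (ProbabilityTheory.uniformOn (univ : Set (Icc (1 : ℕ) 2))) :=
  ProbabilityTheory.isProbabilityMeasure_uniformOn finite_univ ⟨⟨1, by simp⟩, mem_univ _⟩

instance : IsProbabilityMeasure markLaw := by
  unfold markLaw
  infer_instance

theorem integral_uniformOn_Icc (f : Icc (1 : ℕ) 2 → ℝ) :
    ∫ κ, f κ ∂(ProbabilityTheory.uniformOn univ) =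
      (f ⟨1, by simp⟩ + f ⟨2, by simp⟩) / 2 := by
  have hcard : Fintype.card (Icc (1 : ℕ) 2) = 2 := by simp
  have hreal (κ : Icc (1 : ℕ) 2) :
      (ProbabilityTheory.uniformOn (univ : Set (Icc (1 : ℕ) 2))).real {κ} = 1 / 2 := by
    rw [measureReal_def, ProbabilityTheory.uniformOn_univ, hcard]
    simp
  have huniv : (Finset.univ : Finset (Icc (1 : ℕ) 2)) = {⟨1, by simp⟩, ⟨2, by simp⟩} := by
    decide
  rw [integral_fintype .of_finite, huniv, Finset.sum_pair (by simp)]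
  simp only [hreal, smul_eq_mul]
  ring

theorem integral_unitInterval (g : ℝ → ℝ) :
    ∫ τ : unitInterval, g τ = ∫ s in (0 : ℝ)..1, g s := by
  rw [intervalIntegral.integral_of_le zero_le_one, ← integral_Icc_eq_integral_Ioc]
  exact integral_subtype measurableSet_Icc g

theorem integral_markLaw {F : Mark → ℝ} (hF : BddMeasurable F) :
    ∫ ω, F ω ∂markLaw =
      1 / 2 * (∫ τ, F (cutMark τ)) + 1 / 2 * ∫ τ, F (minMark τ) := by
  have h1 : BddMeasurable fun τ => F (cutMark τ) :=
    hF.comp (measurable_id.prodMk measurable_const)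
  have h2 : BddMeasurable fun τ => F (minMark τ) := hF.comp measurable_minMark
  have h := integral_prod F
    (hF.integrable ((volume : Measure unitInterval).prod
      (ProbabilityTheory.uniformOn (univ : Set (Icc (1 : ℕ) 2)))))
  rw [markLaw, h]
  simp only [integral_uniformOn_Icc]
  rw [integral_div]
  change (∫ τ, (F (cutMark τ) + F (minMark τ))) / 2 = _
  rw [integral_add (h1.integrable _) (h2.integrable _)]
  ring

instance (ρ : ProbabilityMeasure (BurnTime × BurnTime)) :
    IsProbabilityMeasure (bivariateMap ρ) :=
  Measure.isProbabilityMeasure_map measurable_chi₂.aemeasurable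

/-- Conditioning on `κ` gives two terms of weight one half: the cut term is linear in `ρ`, the
minimum term quadratic. -/
theorem integral_bivariateMap (ρ : ProbabilityMeasure (BurnTime × BurnTime))
    {f : BurnTime × BurnTime → ℝ} (hf : BddMeasurable f) :
    ∫ p, f p ∂(bivariateMap ρ) =
      1 / 2 * (∫ s in (0 : ℝ)..1, ∫ p, f (cut₂ s p) ∂(ρ : Measure (BurnTime × BurnTime))) +
      1 / 2 * ∫ p, ∫ q, f (p ⊓ q) ∂(ρ : Measure (BurnTime × BurnTime))
        ∂(ρ : Measure (BurnTime × BurnTime)) := by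
  set μ : Measure (BurnTime × BurnTime) := (ρ : Measure (BurnTime × BurnTime)) with hμ
  have hstep : BddMeasurable fun p => f (chi₂ p) := hf.comp measurable_chi₂
  have hF : BddMeasurable fun ω => ∫ q, f (chi₂ (ω, q)) ∂(μ.prod μ) :=
    BddMeasurable.integral (f := fun ω q => f (chi₂ (ω, q))) hstep _
  have hmap : ∫ p, f p ∂(bivariateMap ρ) = ∫ p, f (chi₂ p) ∂(markLaw.prod (μ.prod μ)) :=
    integral_map measurable_chi₂.aemeasurable hf.1.aestronglyMeasurable
  rw [hmap, integral_prod _ (hstep.integrable _), integral_markLaw hF]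
  have hcut (τ : unitInterval) :
      ∫ q, f (chi₂ (cutMark τ, q)) ∂(μ.prod μ) = ∫ p, f (cut₂ τ p) ∂μ := by
    simp only [chi₂, chi_cutMark]
    have := integral_fun_fst (μ := μ) (ν := μ) (fun p => f (cut₂ τ p))
    simpa [cut₂] using this
  have hmin (τ : unitInterval) :
      ∫ q, f (chi₂ (minMark τ, q)) ∂(μ.prod μ) = ∫ p, ∫ q, f (p ⊓ q) ∂μ ∂μ := by
    simp only [chi₂, chi_minMark]
    exact integral_prod (fun q => f (q.1 ⊓ q.2)) ((hf.comp measurable_inf₂).integrable _)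
  simp only [hcut, hmin]
  rw [integral_unitInterval fun s => ∫ p, f (cut₂ s p) ∂μ]
  simp

theorem SolvesBivariateRDE.integral_eq {ρ : ProbabilityMeasure (BurnTime × BurnTime)}
    (hsol : SolvesBivariateRDE ρ) {f : BurnTime × BurnTime → ℝ} (hf : BddMeasurable f) :
    ∫ p, f p ∂(ρ : Measure (BurnTime × BurnTime)) =
      1 / 2 * (∫ s in (0 : ℝ)..1, ∫ p, f (cut₂ s p) ∂(ρ : Measure (BurnTime × BurnTime))) +
      1 / 2 * ∫ p, ∫ q, f (p ⊓ q) ∂(ρ : Measure (BurnTime × BurnTime))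
        ∂(ρ : Measure (BurnTime × BurnTime)) := by
  rw [← integral_bivariateMap ρ hf, ← hsol]

/-! ### The mass bound for solutions -/

/-- A minimum is in `burntBy t` exactly when one of the two points is; this is inclusion-exclusion
for that union. -/
theorem indicator_burntBy_inf (t : ℝ) (p q : BurnTime × BurnTime) :
    (burntBy t).indicator (1 : BurnTime × BurnTime → ℝ) (p ⊓ q) =
      (burntBy t).indicator (1 : BurnTime × BurnTime → ℝ) p +
        (1 - (burntBy t).indicator (1 : BurnTime × BurnTime → ℝ) p) *
          (burntBy t).indicator (1 : BurnTime × BurnTime → ℝ) q := by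
  have h : p ⊓ q ∈ burntBy t ↔ p ∈ burntBy t ∨ q ∈ burntBy t := by
    have h1 (x y : BurnTime) : ((x ⊓ y : BurnTime) : ℝ≥0∞) ≤ ENNReal.ofReal t ↔
        (x : ℝ≥0∞) ≤ ENNReal.ofReal t ∨ (y : ℝ≥0∞) ≤ ENNReal.ofReal t := by
      rcases le_total x y with hxy | hxy
      · rw [inf_eq_left.2 hxy]
        exact ⟨Or.inl, fun h => h.elim id fun h => le_trans (show (x : ℝ≥0∞) ≤ y from hxy) h⟩
      · rw [inf_eq_right.2 hxy]
        exact ⟨Or.inr, fun h => h.elim (fun h => le_trans (show (y : ℝ≥0∞) ≤ x from hxy) h) id⟩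
    simp only [mem_burntBy, Prod.fst_inf, Prod.snd_inf, h1]
    tauto
  by_cases hp : p ∈ burntBy t <;> by_cases hq : q ∈ burntBy t <;> simp [h, hp, hq]

theorem cut_le_ofReal {s t : ℝ} {y : BurnTime} (h : (cut s y : ℝ≥0∞) ≤ ENNReal.ofReal t) :
    (y : ℝ≥0∞) ≤ ENNReal.ofReal t ∧ s ≤ t := by
  unfold cut at h
  split_ifs at h with hs
  · exact ⟨h, ((ENNReal.ofReal_lt_ofReal_iff').1 (hs.trans_le h)).1.le⟩
  · simp [coe_infty] at h

theorem mem_burntBy_of_cut₂ {s t : ℝ} {p : BurnTime × BurnTime} (h : cut₂ s p ∈ burntBy t) :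
    p ∈ burntBy t ∧ s ≤ t := by
  rcases mem_burntBy.1 h with h | h
  · exact ⟨mem_burntBy.2 (.inl (cut_le_ofReal h).1), (cut_le_ofReal h).2⟩
  · exact ⟨mem_burntBy.2 (.inr (cut_le_ofReal h).1), (cut_le_ofReal h).2⟩

theorem measureReal_burntBy_le {ρ : ProbabilityMeasure (BurnTime × BurnTime)}
    (hsol : SolvesBivariateRDE ρ) {t : ℝ} (ht0 : 0 ≤ t) (ht1 : t ≤ 1) :
    (ρ : Measure (BurnTime × BurnTime)).real (burntBy t) ≤ t := by
  set μ : Measure (BurnTime × BurnTime) := (ρ : Measure (BurnTime × BurnTime)) with hμ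
  set f : BurnTime × BurnTime → ℝ := (burntBy t).indicator 1 with hf_def
  have hf : BddMeasurable f := .indicator_one (measurableSet_burntBy t)
  have hG : ∫ p, f p ∂μ = μ.real (burntBy t) := integral_indicator_one (measurableSet_burntBy t)
  set G := μ.real (burntBy t) with hG_def
  have hG0 : 0 ≤ G := measureReal_nonneg
  have hmin : ∫ p, ∫ q, f (p ⊓ q) ∂μ ∂μ = G + (1 - G) * G := by
    have h1 (p : BurnTime × BurnTime) : ∫ q, f (p ⊓ q) ∂μ = f p + (1 - f p) * G := by
      simp only [hf_def, indicator_burntBy_inf]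
      simp only [← hf_def]
      rw [integral_add (integrable_const _) ((hf.integrable μ).const_mul _),
        integral_const_mul, hG]
      simp
    simp only [h1]
    have hint : Integrable (fun p => (1 - f p) * G) μ :=
      ((integrable_const 1).sub (hf.integrable μ)).mul_const G
    rw [integral_add (hf.integrable μ) hint, integral_mul_const,
      integral_sub (integrable_const 1) (hf.integrable μ), hG]
    simp
  have hcutm : BddMeasurable fun s => ∫ p, f (cut₂ s p) ∂μ :=
    BddMeasurable.integral (f := fun s p => f (cut₂ s p)) (hf.comp measurable_cut₂) μ
  have hcut_le (s : ℝ) : ∫ p, f (cut₂ s p) ∂μ ≤ G := by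
    rw [← hG]
    refine integral_mono ((hf.comp (measurable_cut₂.comp
      (measurable_const.prodMk measurable_id))).integrable μ) (hf.integrable μ) fun p => ?_
    by_cases h : cut₂ s p ∈ burntBy t
    · simp [hf_def, h, (mem_burntBy_of_cut₂ h).1]
    · simp only [hf_def, indicator_of_notMem h]
      exact indicator_nonneg (fun _ _ => zero_le_one) p
  have hcut_zero (s : ℝ) (hs : t < s) : ∫ p, f (cut₂ s p) ∂μ = 0 := by
    have (p : BurnTime × BurnTime) : f (cut₂ s p) = 0 :=
      indicator_of_notMem (fun h => hs.not_ge (mem_burntBy_of_cut₂ h).2) _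
    simp [this]
  have hcut : ∫ s in (0 : ℝ)..1, ∫ p, f (cut₂ s p) ∂μ ≤ t * G := by
    rw [← intervalIntegral.integral_add_adjacent_intervals (hcutm.intervalIntegrable 0 t)
      (hcutm.intervalIntegrable t 1)]
    have h1 : ∫ s in (0 : ℝ)..t, ∫ p, f (cut₂ s p) ∂μ ≤ ∫ _ in (0 : ℝ)..t, G :=
      intervalIntegral.integral_mono_on ht0 (hcutm.intervalIntegrable 0 t)
        intervalIntegrable_const fun s _ => hcut_le s
    have h2 : ∫ s in t..1, ∫ p, f (cut₂ s p) ∂μ = 0 := by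
      rw [intervalIntegral.integral_of_le ht1]
      exact setIntegral_eq_zero_of_forall_eq_zero fun s hs => hcut_zero s hs.1
    rw [h2]
    simpa using h1
  have hrde := hsol.integral_eq hf
  rw [← hμ, hG, hmin] at hrde
  -- The RDE says that `G²` equals the cut integral, which is at most `t * G`.
  nlinarith

theorem SolvesBivariateRDE.mem_scalableLaws {ρ : ProbabilityMeasure (BurnTime × BurnTime)}
    (hsymm : IsSymmetricLaw ρ) (hsol : SolvesBivariateRDE ρ) : ρ ∈ scalableLaws := by
  refine ⟨hsymm, fun t ht0 ht1 => ?_⟩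
  rw [← ofReal_measureReal]
  exact ENNReal.ofReal_le_ofReal (measureReal_burntBy_le hsol ht0 ht1)

/-! ### Scaling preserves the RDE -/

/-- Substituting `s ↦ t * s` turns the left side into `t⁻¹ ∫₀ᵗ h`; between `1` and `t` the integrand
`h` is constantly `f infty₂`. -/
theorem integral_cut₂_psi₂ (μ : Measure (BurnTime × BurnTime)) [IsProbabilityMeasure μ]
    {t : ℝ} (ht : 0 < t) {f : BurnTime × BurnTime → ℝ} (hf : BddMeasurable f) :
    ∫ s in (0 : ℝ)..1, ∫ p, f (cut₂ s (psi₂ t p)) ∂μ =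
      t⁻¹ * (∫ s in (0 : ℝ)..1, ∫ p, f (psi₂ t (cut₂ s p)) ∂μ) + (1 - t⁻¹) * f infty₂ := by
  set h : ℝ → ℝ := fun s => ∫ p, f (psi₂ t (cut₂ s p)) ∂μ with hh
  have hm : BddMeasurable h :=
    BddMeasurable.integral (f := fun s p => f (psi₂ t (cut₂ s p)))
      (hf.comp ((measurable_psi₂ t).comp measurable_cut₂)) μ
  have hconst {s : ℝ} (hs : t ≤ s ∨ 1 ≤ s) : h s = f infty₂ := by
    simp [hh, psi₂_cut₂_eq_infty₂ hs]
  -- The oriented integral handles `t ≤ 1` and `t ≥ 1` at once.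
  have htail : ∫ s in (1 : ℝ)..t, h s = (t - 1) * f infty₂ := by
    rw [intervalIntegral.integral_congr (g := fun _ => f infty₂)]
    · simp
    · intro s hs
      rcases le_total t 1 with h1 | h1
      · rw [uIcc_of_ge h1] at hs
        exact hconst (.inl hs.1)
      · rw [uIcc_of_le h1] at hs
        exact hconst (.inr hs.1)
  have hsplit := intervalIntegral.integral_add_adjacent_intervals (hm.intervalIntegrable 0 1)
    (hm.intervalIntegrable 1 t)
  have hscale := intervalIntegral.integral_comp_mul_left (a := 0) (b := 1) h ht.ne'
  simp only [cut₂_psi₂ ht]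
  change ∫ s in (0 : ℝ)..1, h (t * s) = _
  rw [hscale, mul_zero, mul_one, ← hsplit, htail, smul_eq_mul]
  field_simp

theorem solvesBivariateRDE_of_integral_eq {ρ ρ' : ProbabilityMeasure (BurnTime × BurnTime)}
    (hsol : SolvesBivariateRDE ρ) {t : ℝ} (ht : 0 < t)
    (hρ' : ∀ f : BurnTime × BurnTime → ℝ, BddMeasurable f →
      ∫ p, f p ∂(ρ' : Measure (BurnTime × BurnTime)) =
        t⁻¹ * (∫ p, f (psi₂ t p) ∂(ρ : Measure (BurnTime × BurnTime))) +
          (1 - t⁻¹) * f infty₂) :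
    SolvesBivariateRDE ρ' := by
  set μ : Measure (BurnTime × BurnTime) := (ρ : Measure (BurnTime × BurnTime)) with hμ
  set μ' : Measure (BurnTime × BurnTime) := (ρ' : Measure (BurnTime × BurnTime)) with hμ'
  have key (f : BurnTime × BurnTime → ℝ) (hf : BddMeasurable f) :
      ∫ p, f p ∂μ' = ∫ p, f p ∂(bivariateMap ρ') := by
    rw [integral_bivariateMap ρ' hf, ← hμ']
    have hfψ : BddMeasurable fun p => f (psi₂ t p) := hf.comp (measurable_psi₂ t)
    have hcut : ∫ s in (0 : ℝ)..1, ∫ p, f (cut₂ s p) ∂μ' =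
        t⁻¹ * (t⁻¹ * (∫ s in (0 : ℝ)..1, ∫ p, f (psi₂ t (cut₂ s p)) ∂μ) +
          (1 - t⁻¹) * f infty₂) + (1 - t⁻¹) * f infty₂ := by
      have h1 (s : ℝ) : ∫ p, f (cut₂ s p) ∂μ' =
          t⁻¹ * (∫ p, f (cut₂ s (psi₂ t p)) ∂μ) + (1 - t⁻¹) * f infty₂ := by
        rw [hρ' (fun p => f (cut₂ s p))
          (hf.comp (measurable_cut₂.comp (measurable_const.prodMk measurable_id))),
          cut₂_infty₂]
      have hm : BddMeasurable fun s => ∫ p, f (cut₂ s (psi₂ t p)) ∂μ :=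
        BddMeasurable.integral (f := fun s p => f (cut₂ s (psi₂ t p)))
          (hf.comp (measurable_cut₂.comp
            (measurable_fst.prodMk ((measurable_psi₂ t).comp measurable_snd)))) μ
      simp only [h1]
      rw [intervalIntegral.integral_add ((hm.const_mul _).intervalIntegrable _ _)
        intervalIntegrable_const, intervalIntegral.integral_const_mul,
        integral_cut₂_psi₂ μ ht hf]
      simp
    have hmin : ∫ p, ∫ q, f (p ⊓ q) ∂μ' ∂μ' =
        t⁻¹ * (t⁻¹ * (∫ p, ∫ q, f (psi₂ t (p ⊓ q)) ∂μ ∂μ) +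
          (1 - t⁻¹) * ∫ p, f (psi₂ t p) ∂μ) +
        (1 - t⁻¹) * (t⁻¹ * (∫ p, f (psi₂ t p) ∂μ) + (1 - t⁻¹) * f infty₂) := by
      have h1 (p : BurnTime × BurnTime) : ∫ q, f (p ⊓ q) ∂μ' =
          t⁻¹ * (∫ q, f (p ⊓ psi₂ t q) ∂μ) + (1 - t⁻¹) * f p := by
        rw [hρ' (fun q => f (p ⊓ q))
          (hf.comp (measurable_inf₂.comp (measurable_const.prodMk measurable_id))),
          inf_infty₂]
      have hm : BddMeasurable fun p => ∫ q, f (p ⊓ psi₂ t q) ∂μ :=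
        BddMeasurable.integral (f := fun p q => f (p ⊓ psi₂ t q))
          (hf.comp (measurable_inf₂.comp
            (measurable_fst.prodMk ((measurable_psi₂ t).comp measurable_snd)))) μ
      simp only [h1]
      rw [hρ' _ ((hm.const_mul _).add (hf.const_mul _)),
        integral_add (((hm.comp (measurable_psi₂ t)).const_mul _).integrable μ)
          ((hfψ.const_mul _).integrable μ), integral_const_mul, integral_const_mul]
      simp only [infty₂_inf, psi₂_inf]
    rw [hcut, hmin, hρ' f hf]
    have hrde := hsol.integral_eq hfψ
    rw [← hμ] at hrde
    -- The cut and minimum terms carry `t⁻²`; the remaining multiples of `∫ f ∘ psi₂ t` and `f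
    -- infty₂` balance.
    linear_combination (t⁻¹ * t⁻¹) * hrde
  refine Measure.ext fun A hA => ?_
  have h := key _ (.indicator_one hA)
  rw [integral_indicator_one hA, integral_indicator_one hA] at h
  exact (measureReal_eq_measureReal_iff).1 h

/-! ### Positivity and mass bound of the scaled law -/

/-- For `ρ` in `scalableLaws`, the image of `t⁻¹ ρ` under `psi₂ t` dominates the negative part of
`(1 - t⁻¹) δ_(∞,∞)`. -/
theorem smul_dirac_le {ρ : ProbabilityMeasure (BurnTime × BurnTime)} (hρ : ρ ∈ scalableLaws)
    {t : ℝ} (ht : 0 < t) :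
    ENNReal.ofReal (t⁻¹ - 1) • Measure.dirac infty₂ ≤
      ENNReal.ofReal t⁻¹ • (ρ : Measure (BurnTime × BurnTime)).map (psi₂ t) := by
  set μ : Measure (BurnTime × BurnTime) := (ρ : Measure (BurnTime × BurnTime)) with hμ
  rcases le_total 1 t with h1 | h1
  · rw [ENNReal.ofReal_of_nonpos (sub_nonpos.2 (inv_le_one_of_one_le₀ h1)), zero_smul]
    exact Measure.zero_le _
  refine Measure.le_iff.2 fun A hA => ?_
  rw [Measure.smul_apply, Measure.smul_apply, Measure.dirac_apply' _ hA,
    Measure.map_apply (measurable_psi₂ t) hA]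
  by_cases hinf : infty₂ ∈ A
  · have hsub : (burntBy t)ᶜ ⊆ psi₂ t ⁻¹' A := by
      intro p hp
      rw [mem_compl_iff, mem_burntBy, not_or, not_le, not_le] at hp
      have : psi₂ t p = infty₂ := Prod.ext (psi_of_lt hp.1) (psi_of_lt hp.2)
      rwa [mem_preimage, this]
    have hG : μ.real (burntBy t) ≤ t :=
      ENNReal.toReal_le_of_le_ofReal ht.le (hρ.2 t ht.le h1)
    have hle : 1 - t ≤ μ.real (psi₂ t ⁻¹' A) := by
      refine le_trans ?_ (measureReal_mono hsub)
      rw [probReal_compl_eq_one_sub (measurableSet_burntBy t)]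
      linarith
    rw [← ofReal_measureReal (μ := μ), smul_eq_mul, smul_eq_mul,
      ← ENNReal.ofReal_mul (inv_nonneg.2 ht.le)]
    simp only [hinf, indicator_of_mem, Pi.one_apply, mul_one]
    refine ENNReal.ofReal_le_ofReal ?_
    calc t⁻¹ - 1 = t⁻¹ * (1 - t) := by field_simp
      _ ≤ _ := mul_le_mul_of_nonneg_left hle (inv_nonneg.2 ht.le)
  · simp [hinf]

theorem exists_scaledLaw {ρ : ProbabilityMeasure (BurnTime × BurnTime)} (hρ : ρ ∈ scalableLaws)
    {t : ℝ} (ht : 0 < t) :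
    ∃ ρ' : ProbabilityMeasure (BurnTime × BurnTime),
      ∀ f : BurnTime × BurnTime → ℝ, BddMeasurable f →
        ∫ p, f p ∂(ρ' : Measure (BurnTime × BurnTime)) =
          t⁻¹ * (∫ p, f (psi₂ t p) ∂(ρ : Measure (BurnTime × BurnTime))) +
            (1 - t⁻¹) * f infty₂ := by
  set μ : Measure (BurnTime × BurnTime) := (ρ : Measure (BurnTime × BurnTime)) with hμ
  set δ : Measure (BurnTime × BurnTime) := Measure.dirac infty₂ with hδ
  -- The coefficient `1 - t⁻¹` is split into positive and negative parts (truncated by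
  -- `ENNReal.ofReal`), so `m` is a genuine measure for every `t > 0`.
  set ν : Measure (BurnTime × BurnTime) :=
    ENNReal.ofReal t⁻¹ • μ.map (psi₂ t) + ENNReal.ofReal (1 - t⁻¹) • δ with hν
  have : IsProbabilityMeasure (μ.map (psi₂ t)) :=
    Measure.isProbabilityMeasure_map (measurable_psi₂ t).aemeasurable
  have hfin (r : ℝ) (m : Measure (BurnTime × BurnTime)) [IsFiniteMeasure m] :
      IsFiniteMeasure (ENNReal.ofReal r • m) := m.smul_finite ENNReal.ofReal_ne_top
  have := hfin t⁻¹ (μ.map (psi₂ t))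
  have := hfin (1 - t⁻¹) δ
  have := hfin (t⁻¹ - 1) δ
  have hle : ENNReal.ofReal (t⁻¹ - 1) • δ ≤ ν :=
    (smul_dirac_le hρ ht).trans (Measure.le_add_right le_rfl)
  set m : Measure (BurnTime × BurnTime) := ν - ENNReal.ofReal (t⁻¹ - 1) • δ with hm_def
  have hadd : m + ENNReal.ofReal (t⁻¹ - 1) • δ = ν := Measure.sub_add_cancel_of_le hle
  have : IsFiniteMeasure m := isFiniteMeasure_of_le ν Measure.sub_le
  have hint (f : BurnTime × BurnTime → ℝ) (hf : BddMeasurable f) :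
      ∫ p, f p ∂m = t⁻¹ * (∫ p, f (psi₂ t p) ∂μ) + (1 - t⁻¹) * f infty₂ := by
    have h := congrArg (fun m' : Measure (BurnTime × BurnTime) => ∫ p, f p ∂m') hadd
    simp only [hν] at h
    rw [integral_add_measure (hf.integrable _) (hf.integrable _),
      integral_add_measure (hf.integrable _) (hf.integrable _), integral_smul_measure,
      integral_smul_measure, integral_smul_measure, hδ,
      integral_dirac' _ _ hf.1.stronglyMeasurable,
      integral_map (measurable_psi₂ t).aemeasurable hf.1.aestronglyMeasurable] at h
    simp only [ENNReal.toReal_ofReal', smul_eq_mul, max_eq_left (inv_nonneg.2 ht.le)] at h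
    have hmax : max (1 - t⁻¹) 0 - max (t⁻¹ - 1) 0 = 1 - t⁻¹ := by
      have := max_zero_sub_max_neg_zero_eq_self (1 - t⁻¹)
      rwa [neg_sub] at this
    linear_combination h + f infty₂ * hmax
  have hprob : IsProbabilityMeasure m := by
    have h := hint _ (.const 1)
    simp only [integral_const, smul_eq_mul, mul_one, probReal_univ] at h
    refine ⟨?_⟩
    rw [← ofReal_measureReal, h]
    simp
  exact ⟨⟨m, hprob⟩, hint⟩

theorem mem_scalableLaws_of_measureReal_eq {ρ ρ' : ProbabilityMeasure (BurnTime × BurnTime)}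
    (hρ : ρ ∈ scalableLaws) {t : ℝ} (ht : 0 < t)
    (hreal : ∀ A, MeasurableSet A → (ρ' : Measure (BurnTime × BurnTime)).real A =
      t⁻¹ * (ρ : Measure (BurnTime × BurnTime)).real (psi₂ t ⁻¹' A) +
        (1 - t⁻¹) * A.indicator 1 infty₂) :
    ρ' ∈ scalableLaws := by
  set μ : Measure (BurnTime × BurnTime) := (ρ : Measure (BurnTime × BurnTime)) with hμ
  refine ⟨Measure.ext fun A hA => ?_, fun s hs0 hs1 => ?_⟩
  · rw [Measure.map_apply measurable_swap hA]
    refine (measureReal_eq_measureReal_iff).1 ?_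
    rw [hreal _ (measurable_swap hA), hreal _ hA]
    have h1 : μ.real (psi₂ t ⁻¹' (Prod.swap ⁻¹' A)) = μ.real (psi₂ t ⁻¹' A) := by
      have hsymm : μ.map Prod.swap = μ := hρ.1
      conv_rhs => rw [← hsymm]
      rw [map_measureReal_apply measurable_swap (measurable_psi₂ t hA)]
      rfl
    rw [h1]
    rfl
  · change (ρ' : Measure (BurnTime × BurnTime)) (burntBy s) ≤ _
    rw [← ofReal_measureReal, hreal _ (measurableSet_burntBy s)]
    refine ENNReal.ofReal_le_ofReal ?_
    have hinf : infty₂ ∉ burntBy s := by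
      simp [mem_burntBy, infty₂, coe_infty]
    rw [indicator_of_notMem hinf, mul_zero, add_zero, inv_mul_le_iff₀ ht]
    -- Scaling back gives `burntBy (t * s)`, to which the bound for `ρ` applies only if `t * s ≤ 1`;
    -- otherwise total mass 1 suffices.
    rcases le_total (t * s) 1 with h1 | h1
    · have hsub : psi₂ t ⁻¹' burntBy s ⊆ burntBy (t * s) := by
        have hpsi (y : BurnTime) (h : (psi t y : ℝ≥0∞) ≤ ENNReal.ofReal s) :
            (y : ℝ≥0∞) ≤ ENNReal.ofReal (t * s) := by
          rcases le_or_gt (y : ℝ≥0∞) (ENNReal.ofReal t) with hy | hy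
          · rwa [coe_psi_of_le hy, inv_mul_le_ofReal_iff ht] at h
          · simp [psi_of_lt hy, coe_infty] at h
        intro p hp
        exact mem_burntBy.2 ((mem_burntBy.1 hp).imp (hpsi _) (hpsi _))
      exact (measureReal_mono hsub).trans
        (ENNReal.toReal_le_of_le_ofReal (by positivity) (hρ.2 _ (by positivity) h1))
    · exact measureReal_le_one.trans h1

end FrozenPercolation

end

theorem lemma10
    (ρ : MeasureTheory.ProbabilityMeasure
      (FrozenPercolation.BurnTime × FrozenPercolation.BurnTime))
    (hsymm : FrozenPercolation.IsSymmetricLaw ρ)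
    (hsol : FrozenPercolation.SolvesBivariateRDE ρ) :
    ρ ∈ FrozenPercolation.scalableLaws ∧
      ∀ t : ℝ, 0 < t →
        ∃ ρ' : MeasureTheory.ProbabilityMeasure
            (FrozenPercolation.BurnTime × FrozenPercolation.BurnTime),
          (ρ' : MeasureTheory.Measure
              (FrozenPercolation.BurnTime × FrozenPercolation.BurnTime)).toSignedMeasure =
            FrozenPercolation.gamma₂ t ρ ∧
          ρ' ∈ FrozenPercolation.scalableLaws ∧
          FrozenPercolation.SolvesBivariateRDE ρ' := by
  have hρ := FrozenPercolation.SolvesBivariateRDE.mem_scalableLaws hsymm hsol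
  refine ⟨hρ, fun t ht => ?_⟩
  obtain ⟨ρ', hρ'⟩ := FrozenPercolation.exists_scaledLaw hρ ht
  have hreal (A : Set (FrozenPercolation.BurnTime × FrozenPercolation.BurnTime))
      (hA : MeasurableSet A) :
      (ρ' : MeasureTheory.Measure _).real A =
        t⁻¹ * (ρ : MeasureTheory.Measure _).real (FrozenPercolation.psi₂ t ⁻¹' A) +
          (1 - t⁻¹) * A.indicator 1 FrozenPercolation.infty₂ := by
    have h := hρ' _ (.indicator_one hA)
    rw [MeasureTheory.integral_indicator_one hA] at h
    rw [h, ← MeasureTheory.integral_indicator_one (FrozenPercolation.measurable_psi₂ t hA)]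
    rfl
  refine ⟨ρ', ?_, FrozenPercolation.mem_scalableLaws_of_measureReal_eq hρ ht hreal,
    FrozenPercolation.solvesBivariateRDE_of_integral_eq hsol ht hρ'⟩
  refine MeasureTheory.VectorMeasure.ext fun A hA => ?_
  rw [MeasureTheory.Measure.toSignedMeasure_apply_measurable hA, hreal A hA]
  simp only [FrozenPercolation.gamma₂, add_apply,
    smul_apply, smul_eq_mul]
  rw [MeasureTheory.Measure.toSignedMeasure_apply_measurable hA,
    MeasureTheory.Measure.toSignedMeasure_apply_measurable hA,
    MeasureTheory.map_measureReal_apply (FrozenPercolation.measurable_psi₂ t) hA,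
    MeasureTheory.measureReal_def (MeasureTheory.Measure.dirac _),
    MeasureTheory.Measure.dirac_apply' _ hA]
  congr 2
  by_cases h : (FrozenPercolation.BurnTime.infty, FrozenPercolation.BurnTime.infty) ∈ A <;>
    simp [h, FrozenPercolation.infty₂]
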